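/- Graphs are finite, simple, undirected and nonempty; $\chi(G)$ and $\omega(G)$ denote the chromatic number and the clique number of $G$. For $X\subseteq V(G)$ the cut-rank $\rho_G(X)$ is the rank over $\mathbb F_2$ of the $X\times(V(G)\setminus X)$ $0$-$1$ adjacency matrix (and $0$ if $X=\emptyset$ or $X=V(G)$). A rank decomposition of $G$ is a pair $(T,L)$ where $T$ is a finite tree with at least two nodes, all of whose nodes have degree $1$ or $3$, and $L$ is a bijection from $V(G)$ to the set of leaves of $T$. Its width is the maximum, over the edges $e$ of $T$, of $\rho_G(L^{-1}(X_e))$, where $X_e$ is the set of leaves of one of the two components of $T-e$. The rankwidth $\mathrm{rw}(G)$ is the minimum width of a rank decomposition of $G$ (and $0$ if $G$ has only one vertex). For $r\in\mathbb N$, call a real polynomial $P$ in one variable *admissible for $r$* if $\chi(G)\le P(\omega(G))$ for every graph $G$ with $\mathrm{rw}(G)\le r$. **Theorem.** If $P_r$ is admissible for $r$, then $\deg P_r=\Omega(\log r)$, and in fact $\deg P_r\ge\bigl(\frac{1}{2\log 2}-o(1)\bigr)\log r$, uniformly in the choice of $P_r$ ($\log$ is the natural logarithm). That is: 1. there are a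 constant $c>0$ and an $r_0\in\mathbb N$ such that for every $r\ge r_0$ and every polynomial $P$ that is admissible for $r$, $\deg P\ge c\log r$; 2. there is a function $\varepsilon:\mathbb N\to\mathbb R$ with $\varepsilon(r)\to 0$ as $r\to\infty$ such that for every $r\ge 1$ and every polynomial $P$ that is admissible for $r$, $\deg P\ge\bigl(\frac{1}{2\log 2}-\varepsilon(r)\bigr)\log r$. -/

import Mathlib

open Filter Topology

universe u

section Rankwidth

open Classical in
/-- The cut-rank of `X` in `G`: the rank over the two-element field of the `X × (V ∖ X)`
adjacency matrix. (It is `0` when `X` is empty or everything, the matrix then being empty.) -/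
noncomputable def cutRank {V : Type u} [Fintype V] (G : SimpleGraph V) (X : Set V) : ℕ :=
  (Matrix.of fun (a : {v // v ∈ X}) (b : {v // v ∉ X}) =>
    if G.Adj a.1 b.1 then (1 : ZMod 2) else 0).rank

/-- The data of a rank decomposition of a graph with vertex set `V`: a finite tree with at least
two nodes in which every node has degree `1` or `3`, and a bijection from `V` to its leaves. -/
structure RankDecomposition (V : Type u) where
  node : Type
  [fintypeNode : Fintype node]
  [nontrivialNode : Nontrivial node]
  tree : SimpleGraph node
  isTree : tree.IsTree
  subcubic : ∀ t : node, (tree.neighborSet t).ncard = 1 ∨ (tree.neighborSet t).ncard = 3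
  leaf : V ≃ {t : node // (tree.neighborSet t).ncard = 1}

attribute [instance] RankDecomposition.fintypeNode RankDecomposition.nontrivialNode

/-- The vertices of the graph whose leaf lies, after deletion of the tree edge `{s, t}`,
in the same connected component as `s`. -/
def RankDecomposition.side {V : Type u} (D : RankDecomposition V) (s t : D.node) : Set V :=
  {v | (D.tree.deleteEdges {s(s, t)}).Reachable s (D.leaf v).1}

open Classical in
/-- The width of a rank decomposition: the maximum, over the edges of the tree, of the cut-rank
of either part of the induced bipartition. Every edge is considered in both orientations, which
makes no difference as the cut-rank is symmetric. -/
noncomputable def RankDecomposition.width {V : Type u} [Fintype V] (D : RankDecomposition V)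
    (G : SimpleGraph V) : ℕ :=
  Finset.univ.sup fun d : D.tree.Dart => cutRank G (D.side d.fst d.snd)

/-- The rankwidth of a finite graph: the minimum width of a rank decomposition. Every graph with
at least two vertices has a rank decomposition; graphs with at most one vertex have none, and
their rankwidth is `0` by the usual convention (which is the value of `sInf ∅` in `ℕ`). -/
noncomputable def rankwidth {V : Type u} [Fintype V] (G : SimpleGraph V) : ℕ :=
  sInf {k | ∃ D : RankDecomposition V, D.width G = k}

end Rankwidth

/-- `P` satisfies `χ(G) ≤ P(ω(G))` for all (finite, nonempty, simple) graphs `G` of rankwidth at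
most `r`. -/
def IsChiBounding (r : ℕ) (P : Polynomial ℝ) : Prop :=
  ∀ (V : Type) [Fintype V] [Nonempty V] (G : SimpleGraph V), rankwidth G ≤ r →
    (G.chromaticNumber.toNat : ℝ) ≤ P.eval (G.cliqueNum : ℝ)

/-! It suffices to find, for every prime p and every m, a graph of rankwidth at most 2p² with ω ≤
2^m and χ ≥ (p/2)^m. Letting m grow forces p ≤ 2^(deg P + 1), and Bertrand's postulate supplies a p
of order √r.

For m = 1 the graph is the flag graph of an affine plane without its vertical lines. It has p³
flags, no triangle since two points lie on at most one common line, and no independent set larger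
than 2p². For general m its lexicographic power is taken: ω and α are at most multiplied, and χ ≥
|V|/α.

The crux is that these powers keep the same bound on rankwidth. Substitute a decomposition of H for
each leaf of one of G. A vertex outside a copy of H sees that copy completely or not at all, so it
adds only zero or all-ones columns to a cut matrix inside the copy. `CutFactor` requires the
all-ones column to lie in the column span already, so such columns cost no rank
(`CutFactor.lexProduct_right`). Decompositions are handled as nested disjoint unions (`Branched`)
and become trees only in `Branched.exists_rankDecomposition`. -/

/-! ### Rooted forests and the cuts given by their edges -/

/-- A finite rooted forest, given by its parent function and a depth function witnessing that
the parent function has no cycles. -/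
structure ParentForest (N : Type) where
  parent : N → Option N
  depth : N → ℕ
  depth_lt : ∀ {x y}, parent x = some y → depth y < depth x

namespace ParentForest

variable {N M : Type}

/-- `F.Below x y`: the node `y` is a descendant of `x` (possibly `x` itself). -/
def Below (F : ParentForest N) (x y : N) : Prop :=
  Relation.ReflTransGen (fun u v => F.parent u = some v) y x

theorem Below.depth_le {F : ParentForest N} {x y : N} (h : F.Below x y) :
    F.depth x ≤ F.depth y := by
  induction h using Relation.ReflTransGen.head_induction_on with
  | refl => exact le_rfl
  | head h _ ih => exact ih.trans (F.depth_lt h).le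

/-- The underlying graph of a forest. -/
def graph (F : ParentForest N) : SimpleGraph N where
  Adj x y := F.parent x = some y ∨ F.parent y = some x
  symm := ⟨fun _ _ h => h.symm⟩
  loopless := ⟨fun x h => by
    rcases h with h | h <;> exact absurd (F.depth_lt h) (lt_irrefl _)⟩

/-- The deleted edge is the only one that leaves the set of descendants of `x`. -/
theorem reachable_child_iff (F : ParentForest N) {x p : N} (hp : F.parent x = some p) (z : N) :
    (F.graph.deleteEdges {s(x, p)}).Reachable x z ↔ F.Below x z := by
  have hxp := F.depth_lt hp
  constructor
  · rw [SimpleGraph.reachable_iff_reflTransGen]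
    intro h
    induction h with
    | refl => exact Relation.ReflTransGen.refl
    | @tail z w _ hzw ih =>
      rw [SimpleGraph.deleteEdges_adj] at hzw
      obtain ⟨h | h, hne⟩ := hzw
      · rcases Relation.ReflTransGen.cases_head ih with rfl | ⟨c, hc, hcx⟩
        · rw [h] at hp
          obtain rfl := Option.some.inj hp
          exact absurd rfl hne
        · rw [h] at hc
          obtain rfl := Option.some.inj hc
          exact hcx
      · exact Relation.ReflTransGen.head h ih
  · intro h
    induction h using Relation.ReflTransGen.head_induction_on with
    | refl => exact SimpleGraph.Reachable.refl _
    | @head z w hzw hwx ih =>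
      have h1 := F.depth_lt hzw
      have h2 := Below.depth_le (F := F) hwx
      refine ih.trans (SimpleGraph.Adj.reachable ?_)
      rw [SimpleGraph.deleteEdges_adj]
      refine ⟨Or.inr hzw, fun he => ?_⟩
      rcases Sym2.eq_iff.1 he with ⟨rfl, rfl⟩ | ⟨rfl, rfl⟩ <;> omega

/-- The tree obtained from a forest by adding a common root. -/
def addRoot (F : ParentForest N) : ParentForest (Option N) where
  parent := Option.map F.parent
  depth o := o.elim 0 fun x => F.depth x + 1
  depth_lt := by
    rintro (_ | x) y h
    · simp at h
    · obtain rfl : F.parent x = y := by simpa using h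
      rcases hx : F.parent x with _ | z
      · simp
      · simpa using F.depth_lt hx

/-- The path from `z` up to the root avoids `x`, hence every edge at `x`. -/
theorem addRoot_reachable_none (F : ParentForest N) (x p : Option N) (z : Option N) (hz : ¬ F.addRoot.Below x z) :
    (F.addRoot.graph.deleteEdges {s(x, p)}).Reachable z none := by
  induction hd : F.addRoot.depth z using Nat.strong_induction_on generalizing z with
  | _ d ih =>
    rcases z with _ | y
    · exact SimpleGraph.Reachable.refl _
    · have hw : F.addRoot.parent (some y) = some (F.parent y) := rfl
      have hnb : ¬ F.addRoot.Below x (F.parent y) := fun h =>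
        hz (Relation.ReflTransGen.head hw h)
      refine SimpleGraph.Reachable.trans (SimpleGraph.Adj.reachable ?_)
        (ih _ (hd ▸ F.addRoot.depth_lt hw) _ hnb rfl)
      rw [SimpleGraph.deleteEdges_adj]
      refine ⟨Or.inl hw, fun he => ?_⟩
      rcases Sym2.eq_iff.1 he with ⟨h, -⟩ | ⟨-, h⟩
      · exact hz (h ▸ Relation.ReflTransGen.refl)
      · exact hnb (h ▸ Relation.ReflTransGen.refl)

theorem not_below_parent (F : ParentForest N) {x p : N} (hp : F.parent x = some p) :
    ¬ F.Below x p := fun h => absurd h.depth_le (F.depth_lt hp).not_ge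

theorem addRoot_reachable_parent_iff (F : ParentForest N) {x p : Option N}
    (hp : F.addRoot.parent x = some p) (z : Option N) :
    (F.addRoot.graph.deleteEdges {s(x, p)}).Reachable p z ↔ ¬ F.addRoot.Below x z := by
  have hpx := F.addRoot.not_below_parent hp
  constructor
  · intro h hz
    rw [← F.addRoot.reachable_child_iff hp] at hz hpx
    exact hpx (hz.trans h.symm)
  · intro h
    exact (F.addRoot_reachable_none x p p hpx).trans (F.addRoot_reachable_none x p z h).symm

theorem addRoot_connected (F : ParentForest N) : F.addRoot.graph.Connected := by
  have key : ∀ z, F.addRoot.graph.Reachable z none := by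
    intro z
    induction hd : F.addRoot.depth z using Nat.strong_induction_on generalizing z with
    | _ d ih =>
      rcases z with _ | y
      · exact SimpleGraph.Reachable.refl _
      · have hw : F.addRoot.parent (some y) = some (F.parent y) := rfl
        exact (SimpleGraph.Adj.reachable (Or.inl hw)).trans
          (ih _ (hd ▸ F.addRoot.depth_lt hw) _ rfl)
  exact ⟨fun x y => (key x).trans (key y).symm⟩

theorem isAcyclic (F : ParentForest N) : F.graph.IsAcyclic := by
  rw [SimpleGraph.isAcyclic_iff_forall_adj_isBridge]
  have key : ∀ x p, F.parent x = some p → F.graph.IsBridge s(x, p) := by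
    intro x p hp
    rw [SimpleGraph.isBridge_iff, F.reachable_child_iff hp]
    exact F.not_below_parent hp
  rintro x p (h | h)
  · exact key x p h
  · rw [Sym2.eq_swap]
    exact key p x h

theorem addRoot_isTree (F : ParentForest N) : F.addRoot.graph.IsTree :=
  ⟨F.addRoot_connected, F.addRoot.isAcyclic⟩

/-- The disjoint union of two forests. -/
def sum (F : ParentForest N) (F' : ParentForest M) : ParentForest (N ⊕ M) where
  parent := Sum.elim (fun x => (F.parent x).map Sum.inl) (fun x => (F'.parent x).map Sum.inr)
  depth := Sum.elim F.depth F'.depth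
  depth_lt := by
    rintro (x | x) y h
    · obtain ⟨z, hz, rfl⟩ : ∃ z, F.parent x = some z ∧ Sum.inl z = y := by simpa using h
      exact F.depth_lt hz
    · obtain ⟨z, hz, rfl⟩ : ∃ z, F'.parent x = some z ∧ Sum.inr z = y := by simpa using h
      exact F'.depth_lt hz

/-- The children of a node. -/
def children (F : ParentForest N) (x : N) : Set N := {y | F.parent y = some x}

/-- The labels that occur below a node. -/
def labels {V : Type u} (F : ParentForest N) (l : N → Option V) (x : N) : Set V :=
  {v | ∃ y, F.Below x y ∧ l y = some v}

/-- If children go onto children, then subtrees go onto subtrees. This transports labels when a tree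
is placed under a new root. -/
theorem labels_eq_of_children {V : Type u} {F : ParentForest N} {F' : ParentForest M}
    {l : N → Option V} {l' : M → Option V} (f : N → M) (hl : ∀ x, l' (f x) = l x)
    (hf : ∀ x, F'.children (f x) = f '' F.children x) (x : N) :
    F'.labels l' (f x) = F.labels l x := by
  have h1 : ∀ y, F.Below x y → F'.Below (f x) (f y) := by
    intro y h
    induction h using Relation.ReflTransGen.head_induction_on with
    | refl => exact Relation.ReflTransGen.refl
    | @head y z h _ ih =>
      have : f y ∈ F'.children (f z) := by rw [hf]; exact ⟨y, h, rfl⟩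
      exact Relation.ReflTransGen.head this ih
  have h2 : ∀ y', F'.Below (f x) y' → ∃ y, F.Below x y ∧ f y = y' := by
    intro y' h
    induction h using Relation.ReflTransGen.head_induction_on with
    | refl => exact ⟨x, Relation.ReflTransGen.refl, rfl⟩
    | @head y' z' h _ ih =>
      obtain ⟨z, hz, rfl⟩ := ih
      have : y' ∈ F'.children (f z) := h
      rw [hf] at this
      obtain ⟨y, hy, rfl⟩ := this
      exact ⟨y, Relation.ReflTransGen.head hy hz, rfl⟩
  ext v
  constructor
  · rintro ⟨y', hy', hv⟩
    obtain ⟨y, hy, rfl⟩ := h2 y' hy'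
    exact ⟨y, hy, hl y ▸ hv⟩
  · rintro ⟨y, hy, hv⟩
    exact ⟨f y, h1 y hy, (hl y).trans hv⟩

theorem addRoot_children_some (F : ParentForest N) (x : N) :
    F.addRoot.children (some x) = some '' F.children x := by
  ext (_ | y) <;> simp [children, addRoot]

theorem addRoot_children_none (F : ParentForest N) :
    F.addRoot.children none = some '' {x | F.parent x = none} := by
  ext (_ | y) <;> simp [children, addRoot]

theorem sum_children_inl (F : ParentForest N) (F' : ParentForest M) (x : N) :
    (F.sum F').children (Sum.inl x) = Sum.inl '' F.children x := by
  ext (y | y) <;> simp [children, sum]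

theorem sum_children_inr (F : ParentForest N) (F' : ParentForest M) (x : M) :
    (F.sum F').children (Sum.inr x) = Sum.inr '' F'.children x := by
  ext (y | y) <;> simp [children, sum]

theorem addRoot_below_none (F : ParentForest N) (x : Option N) : F.addRoot.Below none x := by
  induction hd : F.addRoot.depth x using Nat.strong_induction_on generalizing x with
  | _ d ih =>
    rcases x with _ | y
    · exact Relation.ReflTransGen.refl
    · have hw : F.addRoot.parent (some y) = some (F.parent y) := rfl
      exact Relation.ReflTransGen.head hw (ih _ (hd ▸ F.addRoot.depth_lt hw) _ rfl)

end ParentForest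

/-! ### From nested unions to rank decompositions -/

/-- `S` is built from singletons by disjoint unions, all sets involved satisfying `P`. -/
inductive Branched {V : Type u} (P : Set V → Prop) : Set V → Prop
  | single (v : V) : P {v} → Branched P {v}
  | union {A B : Set V} : Branched P A → Branched P B → Disjoint A B → P (A ∪ B) →
      Branched P (A ∪ B)

namespace Branched

variable {V : Type u} {P Q : Set V → Prop} {S : Set V}

theorem holds (h : Branched P S) : P S := by
  cases h <;> assumption

theorem mono (hPQ : ∀ X, P X → Q X) (h : Branched P S) : Branched Q S := by
  induction h with
  | single v hv => exact .single v (hPQ _ hv)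
  | union _ _ hd hP hA hB => exact .union hA hB hd (hPQ _ hP)

/-- Rerooting at a leaf. -/
theorem exists_compl_singleton (hP : ∀ X, P X → P Xᶜ) (h : Branched P S)
    (hS : Sᶜ = ∅ ∨ Branched P Sᶜ) : Subsingleton V ∨ ∃ v, Branched P {v}ᶜ := by
  induction h with
  | single v _ =>
    rcases hS with hS | hS
    · left
      have : ∀ w, w = v := fun w => by
        have : w ∈ ({v} : Set V) := by rw [Set.compl_empty_iff.1 hS]; trivial
        exact this
      exact ⟨fun a b => (this a).trans (this b).symm⟩
    · exact Or.inr ⟨v, hS⟩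
  | @union A B hA hB hd hAB ihA _ =>
    -- The root moves one step towards a leaf of `A`: the complement of `A` branches into the
    -- sibling `B` and the part outside `A ∪ B`.
    refine ihA (Or.inr ?_)
    have hc : Aᶜ = B ∪ (A ∪ B)ᶜ := by
      ext v
      have : v ∈ A → v ∉ B := fun h => Set.disjoint_left.1 hd h
      simp only [Set.mem_compl_iff, Set.mem_union]
      tauto
    have hPA := hP _ hA.holds
    rcases hS with hS | hS
    · rw [hc, hS, Set.union_empty]
      exact hB
    · rw [hc] at hPA ⊢
      refine .union hB hS ?_ hPA
      rw [Set.disjoint_left]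
      intro v hv hv'
      exact hv' (Set.mem_union_right _ hv)

open ParentForest in
/-- A branched set is the set of leaf labels of a full binary tree. -/
theorem exists_tree (h : Branched P S) : ∃ (N : Type) (_ : Fintype N) (F : ParentForest N)
    (l : N → Option V), (∃ ρ, {x | F.parent x = none} = {ρ}) ∧
      (∀ x y v, l x = some v → l y = some v → x = y) ∧ (∀ v, v ∈ S ↔ ∃ x, l x = some v) ∧
      (∀ x, (l x).isSome → (F.children x).ncard = 0) ∧
      (∀ x, l x = none → (F.children x).ncard = 2) ∧ ∀ x, P (F.labels l x) := by
  induction h with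
  | single v hv =>
    let F : ParentForest Unit := ⟨fun _ => none, fun _ => 0, fun h => by simp at h⟩
    have hb : ∀ x y, F.Below x y := fun _ _ => Relation.ReflTransGen.refl
    refine ⟨Unit, inferInstance, F, fun _ => some v, ⟨(), ?_⟩, fun _ _ _ _ _ => rfl, ?_, ?_, ?_, ?_⟩
    · ext; simp [F]
    · intro w; simp [eq_comm]
    · intro x _; simp [F, children]
    · intro x h; simp at h
    · intro x
      have : F.labels (fun _ => some v) x = {v} := by
        ext w; simp [labels, hb, eq_comm]
      rw [this]; exact hv
  | @union A B _ _ hd hP hA hB =>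
    obtain ⟨N, _, F, l, ⟨ρ, hρ⟩, hinj, hmem, h0, h2, hF⟩ := hA
    obtain ⟨N', _, F', l', ⟨ρ', hρ'⟩, hinj', hmem', h0', h2', hF'⟩ := hB
    let lab : Option (N ⊕ N') → Option V := fun o => o.elim none (Sum.elim l l')
    have hcl : ∀ x, (F.sum F').addRoot.children (some (Sum.inl x)) =
        (some ∘ Sum.inl) '' F.children x := fun x => by
      rw [addRoot_children_some, sum_children_inl, Set.image_image]; rfl
    have hcr : ∀ x, (F.sum F').addRoot.children (some (Sum.inr x)) =
        (some ∘ Sum.inr) '' F'.children x := fun x => by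
      rw [addRoot_children_some, sum_children_inr, Set.image_image]; rfl
    have hil : Function.Injective (some ∘ Sum.inl : N → Option (N ⊕ N')) :=
      (Option.some_injective _).comp Sum.inl_injective
    have hir : Function.Injective (some ∘ Sum.inr : N' → Option (N ⊕ N')) :=
      (Option.some_injective _).comp Sum.inr_injective
    have hdis : ∀ x y v, l x = some v → l' y = some v → False := fun x y v hx hy =>
      Set.disjoint_left.1 hd ((hmem v).2 ⟨x, hx⟩) ((hmem' v).2 ⟨y, hy⟩)
    have hex : ∀ v, v ∈ A ∪ B ↔ ∃ x, lab x = some v := fun v => by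
      simp [lab, Option.exists, hmem, hmem']
    refine ⟨Option (N ⊕ N'), inferInstance, (F.sum F').addRoot, lab,
      ⟨none, ?_⟩, ?_, hex, ?_, ?_, ?_⟩
    · ext (_ | x) <;> simp [addRoot]
    · rintro (_ | x | x) (_ | y | y) v hx hy
      all_goals simp only [lab, Option.elim, Sum.elim_inl, Sum.elim_inr, reduceCtorEq] at hx hy
      · rw [hinj x y v hx hy]
      · exact (hdis _ _ _ hx hy).elim
      · exact (hdis _ _ _ hy hx).elim
      · rw [hinj' x y v hx hy]
    · rintro (_ | x | x) hx
      · simp [lab] at hx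
      · rw [hcl, Set.ncard_image_of_injective _ hil]; exact h0 x hx
      · rw [hcr, Set.ncard_image_of_injective _ hir]; exact h0' x hx
    · rintro (_ | x | x) hx
      · have : {x | (F.sum F').parent x = none} = {Sum.inl ρ, Sum.inr ρ'} := by
          ext (x | x)
          · simpa [ParentForest.sum] using Set.ext_iff.1 hρ x
          · simpa [ParentForest.sum] using Set.ext_iff.1 hρ' x
        rw [addRoot_children_none, this,
          Set.ncard_image_of_injective _ (Option.some_injective _), Set.ncard_pair (by simp)]
      · rw [hcl, Set.ncard_image_of_injective _ hil]; exact h2 x hx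
      · rw [hcr, Set.ncard_image_of_injective _ hir]; exact h2' x hx
    · rintro (_ | x | x)
      · have : (F.sum F').addRoot.labels lab none = A ∪ B := by
          ext v
          rw [hex]
          simp [labels, addRoot_below_none]
        rw [this]; exact hP
      · have := labels_eq_of_children (F := F) (l := l) (l' := lab) (some ∘ Sum.inl)
          (fun _ => rfl) hcl x
        exact this ▸ hF x
      · have := labels_eq_of_children (F := F') (l := l') (l' := lab) (some ∘ Sum.inr)
          (fun _ => rfl) hcr x
        exact this ▸ hF' x

end Branched

open ParentForest in
-- A new root `none` above the binary tree of `{v₀}ᶜ` has a single neighbour and serves as the leaf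
-- of `v₀`. Every other node gains its parent as a neighbour, so the degrees are 0 + 1 and 2 + 1.
theorem Branched.exists_rankDecomposition {V : Type u} {P : Set V → Prop}
    (hP : ∀ X, P X → P Xᶜ) {v₀ : V} (h : Branched P {v₀}ᶜ) :
    ∃ D : RankDecomposition V, ∀ d : D.tree.Dart, P (D.side d.fst d.snd) := by
  obtain ⟨N, _, F, l, ⟨ρ, hρ⟩, hinj, hmem, h0, h2, hF⟩ := h.exists_tree
  have hnb : ∀ x, F.addRoot.graph.neighborSet (some x) =
      insert (F.parent x) (some '' F.children x) := fun x => by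
    rw [← addRoot_children_some]
    ext y
    simp [graph, children, addRoot, eq_comm]
  have hnb0 : F.addRoot.graph.neighborSet none = {some ρ} := by
    have : F.addRoot.graph.neighborSet none = F.addRoot.children none := by
      ext y
      simp [graph, children, addRoot]
    rw [this, addRoot_children_none, hρ, Set.image_singleton]
  have hcard : ∀ x, (F.addRoot.graph.neighborSet (some x)).ncard = (F.children x).ncard + 1 := by
    intro x
    rw [hnb, Set.ncard_insert_of_notMem _ (Set.toFinite _),
      Set.ncard_image_of_injective _ (Option.some_injective _)]
    rintro ⟨y, hy, hyx⟩
    have h1 := F.depth_lt hy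
    have h2 := F.depth_lt hyx.symm
    omega
  let lab : Option N → Option V := fun o => o.elim (some v₀) l
  have hlab : ∀ x, (lab x).isSome ↔ (F.addRoot.graph.neighborSet x).ncard = 1 := by
    rintro (_ | x)
    · simp [lab, hnb0]
    · rw [hcard]
      rcases hx : l x with _ | v
      · simp [lab, hx, h2 x hx]
      · simp only [lab, Option.elim, hx, Option.isSome_some, h0 x (by simp [hx])]
  have hlv : ∀ x, l x ≠ some v₀ := fun x hx => (hmem v₀).2 ⟨x, hx⟩ rfl
  have hlinj : ∀ x y v, lab x = some v → lab y = some v → x = y := by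
    rintro (_ | x) (_ | y) v hx hy
    · rfl
    · exact (hlv y (hy.trans hx.symm)).elim
    · exact (hlv x (hx.trans hy.symm)).elim
    · rw [hinj x y v hx hy]
  have hlsurj : ∀ v, ∃ x, lab x = some v := fun v => by
    by_cases hv : v = v₀
    · exact ⟨none, hv ▸ rfl⟩
    · obtain ⟨x, hx⟩ := (hmem v).1 hv
      exact ⟨some x, hx⟩
  choose g hg using hlsurj
  let e : V ≃ {t : Option N // (F.addRoot.graph.neighborSet t).ncard = 1} :=
    Equiv.ofBijective (fun v => ⟨g v, (hlab _).1 (by simp [hg])⟩) (by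
      constructor
      · intro v w hvw
        have := congrArg (fun t => lab t.1) hvw
        simpa [hg] using this
      · rintro ⟨t, ht⟩
        obtain ⟨v, hv⟩ := Option.isSome_iff_exists.1 ((hlab t).2 ht)
        exact ⟨v, Subtype.ext (hlinj _ _ v (hg v) hv)⟩)
  have : Nontrivial (Option N) := ⟨⟨none, some ρ, by simp⟩⟩
  refine ⟨⟨Option N, F.addRoot.graph, F.addRoot_isTree, ?_, e⟩, ?_⟩
  · rintro (_ | x)
    · left; simp [hnb0]
    · rw [hcard]
      rcases hx : l x with _ | v
      · right; rw [h2 x hx]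
      · left; rw [h0 x (by simp [hx])]
  · have key : ∀ s t, F.addRoot.parent s = some t → P {v | F.addRoot.Below s (e v).1} := by
      rintro (_ | x) t hst
      · simp [addRoot] at hst
      · have h1 : {v | F.addRoot.Below (some x) (e v).1} = F.addRoot.labels lab (some x) := by
          ext v
          constructor
          · exact fun hv => ⟨g v, hv, hg v⟩
          · rintro ⟨y, hy, hyv⟩
            obtain rfl := hlinj _ _ _ (hg v) hyv
            exact hy
        rw [h1, labels_eq_of_children (F := F) (l := l) some (fun _ => rfl)
          F.addRoot_children_some x]
        exact hF x
    rintro ⟨⟨s, t⟩, hst | hst⟩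
    · simp only [RankDecomposition.side, F.addRoot.reachable_child_iff hst]
      exact key s t hst
    · have : s(s, t) = s(t, s) := Sym2.eq_swap
      simp only [RankDecomposition.side, this, F.addRoot_reachable_parent_iff hst]
      exact hP _ (key t s hst)

/-! ### Factorised cut matrices bound rankwidth -/

/-- On `X × Xᶜ` the adjacency matrix of `G` over the two-element field is a product of matrices
with inner index set `K`, and the all-ones column lies in the column span of the left factor. -/
def CutFactor {V : Type u} (K : Type) [Fintype K] (G : SimpleGraph V) (X : Set V) : Prop :=
  ∃ (u w : K → V → ZMod 2) (e : K → ZMod 2), (∀ x ∈ X, ∑ k, e k * u k x = 1) ∧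
    ∀ x ∈ X, ∀ y ∉ X, (G.Adj x y → ∑ k, u k x * w k y = 1) ∧
      (¬ G.Adj x y → ∑ k, u k x * w k y = 0)

theorem cutRank_le_of_factor {V : Type u} [Fintype V] {K : Type} [Fintype K] {G : SimpleGraph V}
    {X : Set V} (u w : K → V → ZMod 2)
    (h : ∀ x ∈ X, ∀ y ∉ X, (G.Adj x y → ∑ k, u k x * w k y = 1) ∧
      (¬ G.Adj x y → ∑ k, u k x * w k y = 0)) : cutRank G X ≤ Fintype.card K := by
  classical
  unfold cutRank
  have : (Matrix.of fun (a : {v // v ∈ X}) (b : {v // v ∉ X}) =>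
      if G.Adj a.1 b.1 then (1 : ZMod 2) else 0) =
      (Matrix.of fun (a : {v // v ∈ X}) (k : K) => u k a.1) *
        (Matrix.of fun (k : K) (b : {v // v ∉ X}) => w k b.1) := by
    ext a b
    simp only [Matrix.of_apply, Matrix.mul_apply]
    split_ifs with hab
    · exact ((h a.1 a.2 b.1 b.2).1 hab).symm
    · exact ((h a.1 a.2 b.1 b.2).2 hab).symm
  refine (congrArg Matrix.rank this).le.trans ?_
  exact (Matrix.rank_mul_le_left _ _).trans (Matrix.rank_le_card_width _)

theorem rankwidth_le_of_branched {V : Type u} [Fintype V] {K : Type} [Fintype K]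
    {G : SimpleGraph V} (h : Branched (CutFactor K G) Set.univ) :
    rankwidth G ≤ Fintype.card K := by
  -- The all-ones condition singles out one side of the cut. Rerooting needs a property closed under
  -- complements, so only the two rank bounds are kept.
  let P : Set V → Prop := fun X =>
    cutRank G X ≤ Fintype.card K ∧ cutRank G Xᶜ ≤ Fintype.card K
  have hPc : ∀ X, P X → P Xᶜ := fun X hX => ⟨hX.2, by rw [compl_compl]; exact hX.1⟩
  have hP : Branched P Set.univ := h.mono <| by
    rintro X ⟨u, w, -, -, huw⟩
    refine ⟨cutRank_le_of_factor u w huw, cutRank_le_of_factor w u ?_⟩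
    intro x hx y hy
    simp only [mul_comm (w _ x), G.adj_comm x y]
    exact huw y (not_not.1 hy) x hx
  have key : ∀ D : RankDecomposition V, (∀ d : D.tree.Dart, P (D.side d.fst d.snd)) →
      rankwidth G ≤ Fintype.card K := fun D hD => by
    have hw : rankwidth G ≤ D.width G := Nat.sInf_le ⟨D, rfl⟩
    exact hw.trans (Finset.sup_le fun d _ => (hD d).1)
  rcases hP.exists_compl_singleton hPc (Or.inl Set.compl_univ) with hV | ⟨v, hv⟩
  -- With at most one vertex there are no edges. The bound holds whether or not a decomposition
  -- exists, as `sInf ∅ = 0`.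
  · have h0 : ∀ X, cutRank G X = 0 := fun X => by
      classical
      unfold cutRank
      have : (Matrix.of fun (a : {v // v ∈ X}) (b : {v // v ∉ X}) =>
          if G.Adj a.1 b.1 then (1 : ZMod 2) else 0) = 0 := by
        ext a b
        simpa using fun hab => G.ne_of_adj hab (Subsingleton.elim _ _)
      exact (congrArg Matrix.rank this).trans Matrix.rank_zero
    rcases isEmpty_or_nonempty (RankDecomposition V) with hD | hD
    · simp [rankwidth]
    · obtain ⟨D⟩ := hD
      exact key D fun d => ⟨by simp [h0], by simp [h0]⟩
  · obtain ⟨D, hD⟩ := hv.exists_rankDecomposition hPc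
    exact key D hD

/-! ### Branchings along fibres and products -/

namespace Branched

variable {V : Type u} {P : Set V → Prop}

/-- The fibres are attached one by one along a caterpillar, so outside the individual fibres only
unions of fibres occur. -/
theorem of_fibers {ι : Type*} [Finite V] (f : V → ι) {U : Set V} (hU : U.Nonempty)
    (hf : ∀ u ∈ U, Branched P {v | v ∈ U ∧ f v = f u})
    (hP : ∀ T : Set ι, P {v | v ∈ U ∧ f v ∈ T}) : Branched P U := by
  classical
  have key : ∀ T : Finset ι, T.Nonempty → (∀ i ∈ T, ∃ u ∈ U, f u = i) →
      Branched P {v | v ∈ U ∧ f v ∈ T} := by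
    intro T hT
    induction hT using Finset.Nonempty.cons_induction with
    | singleton i =>
      intro h
      obtain ⟨u, hu, rfl⟩ := h i (by simp)
      simpa using hf u hu
    | cons i T hi hT ih =>
      intro h
      obtain ⟨u, hu, rfl⟩ := h i (by simp)
      have hs : {v | v ∈ U ∧ f v ∈ Finset.cons (f u) T hi} =
          {v | v ∈ U ∧ f v = f u} ∪ {v | v ∈ U ∧ f v ∈ T} := by
        ext v
        simp only [Finset.mem_cons, Set.mem_ofPred_eq, Set.mem_union]
        tauto
      rw [hs]
      refine .union (hf u hu) (ih fun i hi => h i (by simp [hi])) ?_ (hs ▸ hP _)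
      rw [Set.disjoint_left]
      rintro v ⟨-, hv⟩ ⟨-, hv'⟩
      exact hi (hv ▸ hv')
  have hfin := U.toFinite
  have := key (hfin.toFinset.image f) (by simpa using hU) (by simp)
  have hs : {v | v ∈ U ∧ f v ∈ hfin.toFinset.image f} = U := by
    ext v
    simp only [Finset.mem_image, Set.Finite.mem_toFinset, Set.mem_ofPred_eq, and_iff_left_iff_imp]
    exact fun hv => ⟨v, hv, rfl⟩
  rwa [hs] at this

/-- Each leaf `v` of the first tree is replaced by a copy of the second. -/
theorem prod {W : Type u} {Q : Set W → Prop} {R : Set (V × W) → Prop} {S : Set V}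
    (hV : Branched P S) (hW : Branched Q Set.univ) (hPR : ∀ A, P A → R (A ×ˢ Set.univ))
    (hQR : ∀ v B, Q B → R ({v} ×ˢ B)) : Branched R (S ×ˢ Set.univ) := by
  induction hV with
  | single v _ =>
    clear hPR
    generalize (Set.univ : Set W) = T at hW
    induction hW with
    | single w hw =>
      rw [Set.singleton_prod_singleton]
      exact .single _ (Set.singleton_prod_singleton ▸ hQR v _ hw)
    | @union A B _ _ hd hAB hA hB =>
      have := hQR v _ hAB
      rw [Set.prod_union] at this ⊢
      exact .union hA hB (Set.disjoint_prod.2 (Or.inr hd)) this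
  | @union A B _ _ hd hAB hA hB =>
    have := hPR _ hAB
    rw [Set.union_prod] at this ⊢
    exact .union hA hB (Set.disjoint_prod.2 (Or.inl hd)) this

end Branched

/-! ### Lexicographic products -/

/-- The lexicographic product of two graphs. -/
def lexProduct {V W : Type u} (G : SimpleGraph V) (H : SimpleGraph W) : SimpleGraph (V × W) where
  Adj x y := G.Adj x.1 y.1 ∨ (x.1 = y.1 ∧ H.Adj x.2 y.2)
  symm := ⟨fun _ _ h => h.imp (fun h => h.symm) fun h => ⟨h.1.symm, h.2.symm⟩⟩
  loopless := ⟨fun _ h => h.elim (fun h => h.ne rfl) fun h => h.2.ne rfl⟩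

section LexProduct

variable {V W : Type u} (G : SimpleGraph V) (H : SimpleGraph W)

theorem lexProduct_compl : (lexProduct G H)ᶜ = lexProduct Gᶜ Hᶜ := by
  ext ⟨v, w⟩ ⟨v', w'⟩
  by_cases hv : v = v'
  · subst hv
    simp [lexProduct]
  · simp [lexProduct, hv]

/-- A clique projects to a clique of `G`, and its fibres are cliques of `H`. -/
theorem cliqueNum_lexProduct_le [Finite V] [Finite W] :
    (lexProduct G H).cliqueNum ≤ G.cliqueNum * H.cliqueNum := by
  classical
  obtain ⟨s, hs⟩ := (lexProduct G H).exists_isNClique_cliqueNum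
  rw [← hs.card_eq]
  have h1 : (s.image Prod.fst).card ≤ G.cliqueNum := by
    refine SimpleGraph.IsClique.card_le_cliqueNum (tc := ?_)
    intro a ha b hb hab
    obtain ⟨x, hx, rfl⟩ := Finset.mem_image.1 (Finset.mem_coe.1 ha)
    obtain ⟨y, hy, rfl⟩ := Finset.mem_image.1 (Finset.mem_coe.1 hb)
    exact (hs.isClique hx hy fun h => hab (h ▸ rfl)).resolve_right fun h => hab h.1
  have h2 : ∀ v ∈ s.image Prod.fst, (s.filter fun x => x.1 = v).card ≤ H.cliqueNum := by
    intro v _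
    have hinj : Set.InjOn Prod.snd (↑(s.filter fun x => x.1 = v) : Set (V × W)) := by
      intro x hx y hy hxy
      rw [Finset.coe_filter] at hx hy
      exact Prod.ext (hx.2.trans hy.2.symm) hxy
    have hc : ((s.filter fun x => x.1 = v).image Prod.snd).card =
        (s.filter fun x => x.1 = v).card := Finset.card_image_of_injOn hinj
    rw [← hc]
    refine SimpleGraph.IsClique.card_le_cliqueNum (tc := ?_)
    intro a ha b hb hab
    obtain ⟨x, hx, rfl⟩ := Finset.mem_image.1 (Finset.mem_coe.1 ha)
    obtain ⟨y, hy, rfl⟩ := Finset.mem_image.1 (Finset.mem_coe.1 hb)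
    rw [Finset.mem_filter] at hx hy
    refine ((hs.isClique hx.1 hy.1 fun h => hab (h ▸ rfl)).resolve_left fun h => ?_).2
    exact h.ne (hx.2.trans hy.2.symm)
  calc s.card ≤ H.cliqueNum * (s.image Prod.fst).card := Finset.card_le_mul_card_image s _ h2
    _ ≤ H.cliqueNum * G.cliqueNum := Nat.mul_le_mul_left _ h1
    _ = _ := mul_comm _ _

theorem indepNum_lexProduct_le [Finite V] [Finite W] :
    (lexProduct G H).indepNum ≤ G.indepNum * H.indepNum := by
  rw [← SimpleGraph.cliqueNum_compl, ← SimpleGraph.cliqueNum_compl, ← SimpleGraph.cliqueNum_compl,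
    lexProduct_compl]
  exact cliqueNum_lexProduct_le _ _

variable {G H}

theorem CutFactor.lexProduct_left {K : Type} [Fintype K] {A : Set V} (h : CutFactor K G A) :
    CutFactor K (lexProduct G H) (A ×ˢ Set.univ) := by
  obtain ⟨u, w, e, he, huw⟩ := h
  refine ⟨fun k x => u k x.1, fun k x => w k x.1, e, fun x hx => he x.1 hx.1, ?_⟩
  rintro ⟨x, x'⟩ ⟨hx, -⟩ ⟨y, y'⟩ hy
  have hy : y ∉ A := fun h => hy ⟨h, trivial⟩
  have hxy : x ≠ y := fun h => hy (h ▸ hx)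
  simpa [lexProduct, hxy] using huw x hx y hy

/-- A column of a vertex outside the copy over `v` is zero or all ones. The coefficients `e` produce
the latter, so the inner index set does not grow. -/
theorem CutFactor.lexProduct_right {K : Type} [Fintype K] {B : Set W} (v : V)
    (h : CutFactor K H B) : CutFactor K (lexProduct G H) ({v} ×ˢ B) := by
  classical
  obtain ⟨u, w, e, he, huw⟩ := h
  refine ⟨fun k x => u k x.2, fun k x => if x.1 = v then w k x.2 else
    if G.Adj v x.1 then e k else 0, e, fun x hx => he x.2 hx.2, ?_⟩
  rintro ⟨x, x'⟩ ⟨hx, hx'⟩ ⟨y, y'⟩ hy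
  obtain rfl : x = v := hx
  by_cases hxy : y = x
  · subst hxy
    have hy : y' ∉ B := fun h => hy ⟨rfl, h⟩
    simpa [lexProduct] using huw x' hx' y' hy
  · have hxy' : x ≠ y := fun h => hxy h.symm
    by_cases hadj : G.Adj x y
    · simpa [lexProduct, hxy, hadj, mul_comm] using he x' hx'
    · simp [lexProduct, hxy, hxy', hadj]

theorem branched_cutFactor_lexProduct {K : Type} [Fintype K]
    (hG : Branched (CutFactor K G) Set.univ) (hH : Branched (CutFactor K H) Set.univ) :
    Branched (CutFactor K (lexProduct G H)) Set.univ := by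
  rw [← Set.univ_prod_univ]
  exact hG.prod hH (fun _ h => h.lexProduct_left) fun v _ h => h.lexProduct_right v

end LexProduct

/-- Iterated lexicographic products of a graph with itself, up to what is recorded about them. -/
theorem exists_lexPower {V : Type} [Fintype V] [Nonempty V] {K : Type} [Fintype K] [Nonempty K]
    {G : SimpleGraph V} (hG : Branched (CutFactor K G) Set.univ) (m : ℕ) :
    ∃ (W : Type) (_ : Fintype W) (_ : Nonempty W) (H : SimpleGraph W),
      Branched (CutFactor K H) Set.univ ∧ Fintype.card W = Fintype.card V ^ m ∧
        H.cliqueNum ≤ G.cliqueNum ^ m ∧ H.indepNum ≤ G.indepNum ^ m := by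
  classical
  induction m with
  | zero =>
    have hc : ∀ H : SimpleGraph Unit, H.cliqueNum ≤ 1 := fun H => by
      obtain ⟨s, hs⟩ := H.exists_isNClique_cliqueNum
      rw [← hs.card_eq]
      exact s.card_le_univ
    refine ⟨Unit, inferInstance, inferInstance, ⊥, ?_, by simp, by simpa using hc _, ?_⟩
    · have hu : (Set.univ : Set Unit) = {()} := Set.eq_singleton_iff_unique_mem.2 ⟨trivial, fun _ _ => rfl⟩
      obtain ⟨k₀⟩ := ‹Nonempty K›
      rw [hu]
      -- Even one vertex needs some index to produce the all-ones column, hence `Nonempty K`.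
      refine .single () ⟨fun _ _ => 1, fun _ _ => 0, fun k => if k = k₀ then 1 else 0, ?_, ?_⟩
      · simp
      · simp
    · rw [← SimpleGraph.cliqueNum_compl]
      simpa using hc _
  | succ m ih =>
    obtain ⟨W, _, _, H, h1, h2, h3, h4⟩ := ih
    refine ⟨V × W, inferInstance, inferInstance, lexProduct G H,
      branched_cutFactor_lexProduct hG h1, ?_, ?_, ?_⟩
    · rw [Fintype.card_prod, h2, pow_succ']
    · rw [pow_succ']
      exact (cliqueNum_lexProduct_le G H).trans (Nat.mul_le_mul_left _ h3)
    · rw [pow_succ']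
      exact (indepNum_lexProduct_le G H).trans (Nat.mul_le_mul_left _ h4)

theorem card_le_chromaticNumber_mul_indepNum {V : Type u} [Fintype V] (G : SimpleGraph V) :
    Fintype.card V ≤ G.chromaticNumber.toNat * G.indepNum := by
  classical
  have hfin : G.chromaticNumber ≠ ⊤ :=
    SimpleGraph.chromaticNumber_ne_top_iff_exists.2 ⟨_, G.colorable_of_fintype⟩
  have hcol : G.Colorable G.chromaticNumber.toNat := by
    rw [← SimpleGraph.chromaticNumber_le_iff_colorable, ENat.natCast_toNat hfin]
  obtain ⟨C⟩ := hcol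
  have := Finset.card_le_mul_card_image_of_maps_to (s := (Finset.univ : Finset V))
    (t := Finset.univ) (f := C) (fun _ _ => Finset.mem_univ _) G.indepNum ?_
  · simpa [mul_comm] using this
  · intro c _
    refine SimpleGraph.IsIndepSet.card_le_indepNum (tc := ?_)
    intro x hx y hy _ hadj
    simp only [Finset.coe_filter, Finset.mem_univ, true_and, Set.mem_ofPred_eq] at hx hy
    exact C.valid hadj (hx.trans hy.symm)

/-! ### The flag graph -/

/-- The graph on the flags of an incidence structure with linearly ordered points, where
`(a, l)` and `(b, k)` with `a < b` and `l ≠ k` are adjacent if `a` lies on `k`. -/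
def flagGraph {A L : Type} [LinearOrder A] (I : A → L → Prop) :
    SimpleGraph {f : A × L // I f.1 f.2} where
  Adj f g := f.1.2 ≠ g.1.2 ∧
    ((f.1.1 < g.1.1 ∧ I f.1.1 g.1.2) ∨ (g.1.1 < f.1.1 ∧ I g.1.1 f.1.2))
  symm := ⟨fun _ _ h => ⟨h.1.symm, h.2.symm⟩⟩
  loopless := ⟨fun _ h => h.1 rfl⟩

section FlagGraph

variable {A L : Type} [LinearOrder A] {I : A → L → Prop}

/-- In a triangle sorted by points, the two smaller points both lie on the lines of the two larger
flags, which are distinct. -/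
theorem flagGraph_cliqueNum_le (hI : ∀ a b l k, I a l → I b l → I a k → I b k → a = b ∨ l = k) :
    (flagGraph I).cliqueNum ≤ 2 := by
  classical
  obtain ⟨s, hs⟩ := (flagGraph I).exists_isNClique_cliqueNum
  by_contra! hlt
  rw [← hs.card_eq, Finset.two_lt_card] at hlt
  obtain ⟨x, hx, y, hy, z, hz, hxy, hxz, hyz⟩ := hlt
  have key : ∀ x y z : {f : A × L // I f.1 f.2}, x.1.1 < y.1.1 → y.1.1 < z.1.1 →
      (flagGraph I).Adj x y → (flagGraph I).Adj x z → (flagGraph I).Adj y z → False := by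
    intro x y z h1 h2 hxy hxz hyz
    have a1 := (hxy.2.resolve_right fun h => h.1.not_gt h1).2
    have a2 := (hxz.2.resolve_right fun h => h.1.not_gt (h1.trans h2)).2
    have a3 := (hyz.2.resolve_right fun h => h.1.not_gt h2).2
    rcases hI _ _ _ _ a1 y.2 a2 a3 with h | h
    · exact h1.ne h
    · exact hyz.1 h
  have hxy := hs.isClique hx hy hxy
  have hxz := hs.isClique hx hz hxz
  have hyz := hs.isClique hy hz hyz
  have hlt : ∀ {x y}, (flagGraph I).Adj x y → x.1.1 < y.1.1 ∨ y.1.1 < x.1.1 := fun h =>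
    h.2.imp (fun h => h.1) fun h => h.1
  rcases hlt hxy with h1 | h1 <;> rcases hlt hxz with h2 | h2 <;> rcases hlt hyz with h3 | h3
  · exact key x y z h1 h3 hxy hxz hyz
  · exact key x z y h2 h3 hxz hxy hyz.symm
  · exact (lt_irrefl _ (h1.trans (h3.trans h2))).elim
  · exact key z x y h2 h1 hxz.symm hyz.symm hxy
  · exact key y x z h1 h2 hxy.symm hyz hxz
  · exact (lt_irrefl _ (h1.trans (h2.trans h3))).elim
  · exact key y z x h3 h2 hyz hxy.symm hxz.symm
  · exact key z y x h3 h1 hyz.symm hxz.symm hxy.symm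

/-- Flags of `s` whose point is the largest on their line within `s` are determined by the line. The
others are determined by the point: if `f` and `g` share a point and `h` is a later flag on the line
of `f`, then `g` and `h` are adjacent. -/
theorem flagGraph_indepNum_le [Fintype A] [Fintype L] :
    (flagGraph I).indepNum ≤ Fintype.card L + Fintype.card A := by
  classical
  obtain ⟨s, hs⟩ := (flagGraph I).exists_isNIndepSet_indepNum
  rw [← hs.card_eq]
  let p : {f : A × L // I f.1 f.2} → Prop := fun f => ∀ g ∈ s, g.1.2 = f.1.2 → g.1.1 ≤ f.1.1
  rw [← Finset.card_filter_add_card_filter_not p]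
  refine Nat.add_le_add ?_ ?_
  · refine Finset.card_le_card_of_injOn (fun f => f.1.2) (fun _ _ => Finset.mem_univ _) ?_
    intro f hf g hg hfg
    simp only [Finset.coe_filter, Set.mem_ofPred_eq] at hf hg
    exact Subtype.ext (Prod.ext (le_antisymm (hg.2 f hf.1 hfg) (hf.2 g hg.1 hfg.symm)) hfg)
  · refine Finset.card_le_card_of_injOn (fun f => f.1.1) (fun _ _ => Finset.mem_univ _) ?_
    intro f hf g hg hfg
    simp only [Finset.coe_filter, Set.mem_ofPred_eq] at hf hg
    by_contra hne
    have hfg' : f.1.2 ≠ g.1.2 := fun h => hne (Subtype.ext (Prod.ext hfg h))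
    obtain ⟨h, hh, hhf, hlt⟩ : ∃ h ∈ s, h.1.2 = f.1.2 ∧ f.1.1 < h.1.1 := by
      simpa [p] using hf.2
    have hfg : f.1.1 = g.1.1 := hfg
    refine hs.isIndepSet hg.1 hh (fun e => hfg' (e ▸ hhf.symm)) ⟨hhf ▸ hfg'.symm, Or.inl ⟨?_, ?_⟩⟩
    · rwa [← hfg]
    · rw [← hfg, hhf]
      exact f.2

/-- Flags are grouped by line, then by point within a line. -/
theorem branched_flagGraph [Fintype A] [Finite L] (hne : ∃ a l, I a l) :
    Branched (CutFactor (A ⊕ A) (flagGraph I)) Set.univ := by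
  classical
  have hl : ∀ (c : A) (g : A → ZMod 2), ∑ a, (if c = a then 1 else 0) * g a = g c := by simp
  have hr : ∀ (c : A) (g : A → ZMod 2), ∑ a, g a * (if c = a then 1 else 0) = g c := by simp
  obtain ⟨a₀, l₀, h₀⟩ := hne
  refine Branched.of_fibers (fun f => f.1.2) ⟨⟨(a₀, l₀), h₀⟩, trivial⟩ ?_ ?_
  · intro f _
    refine Branched.of_fibers (fun f => f.1.1) ⟨f, by simp⟩ ?_ ?_
    · rintro g ⟨-, hg⟩
      have key : {v : {f : A × L // I f.1 f.2} |
          v ∈ {v : {f : A × L // I f.1 f.2} | v ∈ Set.univ ∧ v.1.2 = f.1.2} ∧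
            v.1.1 = g.1.1} = {g} := by
        ext v
        simp only [Set.mem_univ, true_and, Set.mem_ofPred_eq, Set.mem_singleton_iff]
        constructor
        · rintro ⟨h1, h2⟩
          exact Subtype.ext (Prod.ext h2 (h1.trans hg.symm))
        · rintro rfl
          exact ⟨hg, rfl⟩
      rw [key]
      refine .single g ⟨Sum.elim (fun _ _ => 1) fun _ _ => 0,
        Sum.elim (fun a y => if a = a₀ ∧ (flagGraph I).Adj g y then 1 else 0) fun _ _ => 0,
        Sum.elim (fun a => if a = a₀ then 1 else 0) fun _ => 0, ?_, ?_⟩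
      · simp
      · rintro x rfl y -
        constructor <;> intro h <;> simp [h]
    · intro T
      -- On a fixed line the point determines the flag, so rows are indexed by points and one copy
      -- of `A` suffices.
      refine ⟨Sum.elim (fun a x => if x.1.1 = a then 1 else 0) fun _ _ => 0,
        Sum.elim (fun a y => if ∃ h : I a f.1.2, (flagGraph I).Adj ⟨(a, f.1.2), h⟩ y then 1 else 0)
          fun _ _ => 0, fun _ => 1, ?_, ?_⟩
      · simp
      · rintro x ⟨⟨-, hx⟩, -⟩ y -
        have hxI : I x.1.1 f.1.2 := hx ▸ x.2
        have : (⟨(x.1.1, f.1.2), hxI⟩ : {f : A × L // I f.1 f.2}) = x :=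
          Subtype.ext (Prod.ext rfl hx.symm)
        constructor <;> intro h <;> simp [hl, -ite_mul, -mul_ite, hxI, this, h]
  · intro T
    -- One copy of `A` for each way the two points can be ordered, indexed by the smaller point. The
    -- indicators of the point of `x` sum to the all-ones column.
    refine ⟨Sum.elim (fun a x => if x.1.1 = a then 1 else 0)
        fun a x => if a < x.1.1 ∧ I a x.1.2 then 1 else 0,
      Sum.elim (fun a y => if a < y.1.1 ∧ I a y.1.2 then 1 else 0)
        fun a y => if y.1.1 = a then 1 else 0, Sum.elim (fun _ => 1) fun _ => 0, ?_, ?_⟩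
    · simp
    · rintro x ⟨-, hx⟩ y hy
      -- The cut separates whole lines, so the condition of distinct lines holds automatically.
      have hxy : x.1.2 ≠ y.1.2 := fun h => hy ⟨trivial, h ▸ hx⟩
      simp only [Fintype.sum_sum_type, Sum.elim_inl, Sum.elim_inr, hl, hr, flagGraph]
      rcases lt_trichotomy x.1.1 y.1.1 with h | h | h
      · simp [hxy, h, h.not_gt]
      · simp [h]
      · simp [hxy, h, h.not_gt]

end FlagGraph

/-! ### Flags of the affine plane -/

/-- Incidence of points and non-vertical lines in the affine plane over `ZMod p`, with the points
numbered in some way. -/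
def planeIncidence (p : ℕ) (e : Fin (p * p) ≃ ZMod p × ZMod p) (a : Fin (p * p))
    (l : ZMod p × ZMod p) : Prop :=
  (e a).2 = l.1 * (e a).1 + l.2

section PlaneIncidence

variable {p : ℕ} (e : Fin (p * p) ≃ ZMod p × ZMod p)

theorem planeIncidence_eq_or_eq [Fact p.Prime] (a b : Fin (p * p)) (l k : ZMod p × ZMod p)
    (hal : planeIncidence p e a l) (hbl : planeIncidence p e b l) (hak : planeIncidence p e a k)
    (hbk : planeIncidence p e b k) : a = b ∨ l = k := by
  unfold planeIncidence at *
  have h : (l.1 - k.1) * ((e a).1 - (e b).1) = 0 := by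
    linear_combination (-1) * hal + hbl + hak - hbk
  rcases mul_eq_zero.1 h with h | h
  · right
    have h1 := sub_eq_zero.1 h
    refine Prod.ext h1 ?_
    linear_combination (-1) * hal + hak - (e a).1 * h1
  · left
    have h1 := sub_eq_zero.1 h
    refine e.injective (Prod.ext h1 ?_)
    linear_combination hal - hbl + l.1 * h1

/-- A flag of the affine plane is determined by its line and the abscissa of its point. -/
def planeFlagEquiv : {f : Fin (p * p) × ZMod p × ZMod p // planeIncidence p e f.1 f.2} ≃
    (ZMod p × ZMod p) × ZMod p where
  toFun f := (f.1.2, (e f.1.1).1)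
  invFun t := ⟨(e.symm (t.2, t.1.1 * t.2 + t.1.2), t.1), by simp [planeIncidence]⟩
  left_inv := by
    rintro ⟨⟨a, l⟩, h⟩
    have h' : ((e a).1, l.1 * (e a).1 + l.2) = e a := Prod.ext rfl (Eq.symm h)
    simp [h']
  right_inv t := by simp

end PlaneIncidence

/-- From |V| ≤ χα one gets p^(3m) ≤ χ·(2p²)^m, and p^(2m) cancels. -/
theorem exists_graph_rankwidth_le {p : ℕ} (hp : p.Prime) (m : ℕ) :
    ∃ (V : Type) (_ : Fintype V) (_ : Nonempty V) (G : SimpleGraph V),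
      rankwidth G ≤ 2 * p ^ 2 ∧ G.cliqueNum ≤ 2 ^ m ∧ p ^ m ≤ G.chromaticNumber.toNat * 2 ^ m := by
  classical
  have : Fact p.Prime := ⟨hp⟩
  have hp0 := hp.pos
  have e : Fin (p * p) ≃ ZMod p × ZMod p := Fintype.equivOfCardEq (by simp [ZMod.card])
  have : Nonempty {f : Fin (p * p) × ZMod p × ZMod p // planeIncidence p e f.1 f.2} :=
    (planeFlagEquiv e).nonempty
  have hcard : Fintype.card
      {f : Fin (p * p) × ZMod p × ZMod p // planeIncidence p e f.1 f.2} = p ^ 3 := by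
    rw [Fintype.card_congr (planeFlagEquiv e)]
    simp only [Fintype.card_prod, ZMod.card]
    ring
  have : Nonempty (Fin (p * p) ⊕ Fin (p * p)) := ⟨Sum.inl ⟨0, Nat.mul_pos hp0 hp0⟩⟩
  obtain ⟨⟨⟨a, l⟩, hal⟩⟩ := ‹Nonempty {f : Fin (p * p) × ZMod p × ZMod p // _}›
  have hb := branched_flagGraph (I := planeIncidence p e) ⟨a, l, hal⟩
  have : Nonempty {f : Fin (p * p) × ZMod p × ZMod p // planeIncidence p e f.1 f.2} :=
    ⟨⟨⟨a, l⟩, hal⟩⟩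
  obtain ⟨W, _, _, H, h1, h2, h3, h4⟩ := exists_lexPower hb m
  refine ⟨W, inferInstance, inferInstance, H, ?_, ?_, ?_⟩
  · refine (rankwidth_le_of_branched h1).trans (le_of_eq ?_)
    simp only [Fintype.card_sum, Fintype.card_fin]
    ring
  · exact h3.trans (Nat.pow_le_pow_left (flagGraph_cliqueNum_le (planeIncidence_eq_or_eq e)) m)
  · have h5 := flagGraph_indepNum_le (I := planeIncidence p e)
    simp only [Fintype.card_prod, ZMod.card, Fintype.card_fin] at h5
    have h6 := card_le_chromaticNumber_mul_indepNum H
    rw [h2, hcard] at h6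
    have h7 := h6.trans (Nat.mul_le_mul_left _ (h4.trans (Nat.pow_le_pow_left h5 m)))
    refine Nat.le_of_mul_le_mul_right ?_ (pow_pos (Nat.mul_pos hp0 hp0) m)
    calc p ^ m * (p * p) ^ m = (p ^ 3) ^ m := by rw [← mul_pow]; ring
      _ ≤ H.chromaticNumber.toNat * (p * p + p * p) ^ m := h7
      _ = H.chromaticNumber.toNat * 2 ^ m * (p * p) ^ m := by
        rw [mul_assoc, ← mul_pow]; ring

/-! ### The degree bound -/

theorem Polynomial.exists_eval_le_mul_pow (P : Polynomial ℝ) :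
    ∃ C : ℝ, 0 ≤ C ∧ ∀ x : ℝ, 1 ≤ x → P.eval x ≤ C * x ^ P.natDegree := by
  refine ⟨∑ i ∈ Finset.range (P.natDegree + 1), |P.coeff i|,
    Finset.sum_nonneg fun _ _ => abs_nonneg _, fun x hx => ?_⟩
  rw [Polynomial.eval_eq_sum_range, Finset.sum_mul]
  refine Finset.sum_le_sum fun i hi => ?_
  have hi : i ≤ P.natDegree := Nat.lt_succ_iff.1 (Finset.mem_range.1 hi)
  exact mul_le_mul (le_abs_self _) (pow_le_pow_right₀ hx hi) (by positivity) (abs_nonneg _)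

theorem IsChiBounding.prime_le_two_pow {r p : ℕ} {P : Polynomial ℝ} (hP : IsChiBounding r P)
    (hp : p.Prime) (hpr : 2 * p ^ 2 ≤ r) : (p : ℝ) ≤ 2 ^ (P.natDegree + 1) := by
  by_contra! hlt
  obtain ⟨C, hC, hCP⟩ := P.exists_eval_le_mul_pow
  obtain ⟨m, hm⟩ := pow_unbounded_of_one_lt C
    ((one_lt_div (by positivity : (0 : ℝ) < 2 ^ (P.natDegree + 1))).2 hlt)
  obtain ⟨V, _, _, G, h1, h2, h3⟩ := exists_graph_rankwidth_le hp m
  have h4 := hP V G (h1.trans hpr)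
  -- `P` need not be monotone; its majorant C·x^d is, but it is valid only for x ≥ 1.
  have hω : 1 ≤ G.cliqueNum := by
    obtain ⟨v⟩ := ‹Nonempty V›
    have : G.IsClique (({v} : Finset V) : Set V) := by simp
    simpa using SimpleGraph.IsClique.card_le_cliqueNum (tc := this)
  have h5 := hCP G.cliqueNum (by exact_mod_cast hω)
  have h6 : (G.cliqueNum : ℝ) ≤ 2 ^ m := by exact_mod_cast h2
  have h7 : (p : ℝ) ^ m ≤ G.chromaticNumber.toNat * 2 ^ m := by exact_mod_cast h3
  rw [div_pow, lt_div_iff₀ (by positivity)] at hm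
  have h8 : (G.chromaticNumber.toNat : ℝ) ≤ C * (2 ^ m) ^ P.natDegree :=
    h4.trans (h5.trans (by gcongr))
  have : (p : ℝ) ^ m ≤ C * (2 ^ (P.natDegree + 1)) ^ m :=
    calc (p : ℝ) ^ m ≤ C * (2 ^ m) ^ P.natDegree * 2 ^ m :=
          h7.trans (mul_le_mul_of_nonneg_right h8 (by positivity))
      _ = C * (2 ^ (P.natDegree + 1)) ^ m := by
        rw [← pow_mul, ← pow_mul, mul_assoc, ← pow_add]
        ring_nf
  exact absurd hm this.not_gt

theorem IsChiBounding.log_le {r : ℕ} (hr : 1 ≤ r) {P : Polynomial ℝ} (hP : IsChiBounding r P) :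
    Real.log r ≤ (2 * P.natDegree + 5) * Real.log 2 := by
  have h2 : (0 : ℝ) < Real.log 2 := Real.log_pos one_lt_two
  have hr0 : (0 : ℝ) < r := by exact_mod_cast hr
  suffices h : (r : ℝ) ≤ 2 ^ (2 * P.natDegree + 5) by
    have := Real.log_le_log hr0 h
    rw [Real.log_pow] at this
    exact_mod_cast this
  -- Bertrand's k < p ≤ 2k then gives 2p² ≤ 8k² ≤ r ≤ 8p², whence r ≤ 8·4^(d+1) = 2^(2d+5) with d =
  -- deg P. If k = 0, then r < 8.
  set k := Nat.sqrt (r / 8) with hk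
  rcases Nat.eq_zero_or_pos k with hk0 | hk0
  · have h8 : r < 8 := by
      rw [hk, Nat.sqrt_eq_zero] at hk0
      omega
    calc (r : ℝ) ≤ 2 ^ 5 := by
          have : (r : ℝ) < 8 := by exact_mod_cast h8
          linarith
      _ ≤ 2 ^ (2 * P.natDegree + 5) := pow_le_pow_right₀ one_le_two (by omega)
  · obtain ⟨p, hp, hkp, hpk⟩ := Nat.exists_prime_lt_and_le_two_mul k hk0.ne'
    have hk1 : k * k ≤ r / 8 := Nat.sqrt_le _
    have hk2 : r / 8 < (k + 1) * (k + 1) := Nat.lt_succ_sqrt _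
    have hpp : p * p ≤ (2 * k) * (2 * k) := Nat.mul_le_mul hpk hpk
    have hkk : (k + 1) * (k + 1) ≤ p * p := Nat.mul_le_mul hkp hkp
    have hpr : 2 * p ^ 2 ≤ r := by
      rw [pow_two]
      have : (2 * k) * (2 * k) = 4 * (k * k) := by ring
      omega
    have hrp : r ≤ 8 * (p * p) := by omega
    have h := hP.prime_le_two_pow hp hpr
    have hrp : (r : ℝ) ≤ 8 * (p * p) := by exact_mod_cast hrp
    calc (r : ℝ) ≤ 8 * (p * p) := hrp
      _ ≤ 8 * (2 ^ (P.natDegree + 1) * 2 ^ (P.natDegree + 1)) := by gcongr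
      _ = 2 ^ (2 * P.natDegree + 5) := by ring

theorem mainTheorem7 :
    (∃ c : ℝ, 0 < c ∧ ∃ r₀ : ℕ, ∀ r : ℕ, r₀ ≤ r → ∀ P : Polynomial ℝ, IsChiBounding r P →
      c * Real.log r ≤ (P.natDegree : ℝ)) ∧
    (∃ ε : ℕ → ℝ, Tendsto ε atTop (𝓝 0) ∧
      ∀ r : ℕ, 1 ≤ r → ∀ P : Polynomial ℝ, IsChiBounding r P →
        (1 / (2 * Real.log 2) - ε r) * Real.log r ≤ (P.natDegree : ℝ)) := by
  have h2 : (0 : ℝ) < Real.log 2 := Real.log_pos one_lt_two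
  have key : ∀ r : ℕ, 1 ≤ r → ∀ P : Polynomial ℝ, IsChiBounding r P →
      1 / (2 * Real.log 2) * Real.log r - 5 / 2 ≤ P.natDegree := by
    intro r hr P hP
    have := hP.log_le hr
    rw [one_div_mul_eq_div, sub_le_iff_le_add, div_le_iff₀ (by positivity)]
    linarith
  have hlog : Tendsto (fun r : ℕ => Real.log r) atTop atTop :=
    Real.tendsto_log_atTop.comp tendsto_natCast_atTop_atTop
  constructor
  -- Half of the leading constant absorbs the error 5/2 once log r ≥ 10 log 2.
  · refine ⟨1 / (4 * Real.log 2), by positivity, ?_⟩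
    obtain ⟨r₀, hr₀⟩ := eventually_atTop.1 (hlog.eventually_ge_atTop (10 * Real.log 2))
    refine ⟨max r₀ 1, fun r hr P hP => ?_⟩
    have h1 := key r (le_of_max_le_right hr) P hP
    have h3 := hr₀ r (le_of_max_le_left hr)
    have h4 : 5 / 2 ≤ 1 / (4 * Real.log 2) * Real.log r := by
      rw [one_div_mul_eq_div, le_div_iff₀ (by positivity)]
      linarith
    have h5 : 1 / (2 * Real.log 2) * Real.log r =
        1 / (4 * Real.log 2) * Real.log r + 1 / (4 * Real.log 2) * Real.log r := by
      field_simp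
      ring
    linarith
  · refine ⟨fun r => 5 / 2 / Real.log r, hlog.const_div_atTop _, fun r hr P hP => ?_⟩
    rcases hr.eq_or_lt with rfl | hr1
    · simp
    · have hpos : 0 < Real.log r := Real.log_pos (by exact_mod_cast hr1)
      have h1 := key r hr P hP
      rw [sub_mul, div_mul_cancel₀ _ hpos.ne']
      exact h1
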